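/- Throughout, a digraph is finite and has no loops and at most two edges $xy$, $yx$ between any two distinct vertices $x,y$. For a digraph $G$ let $|G|$ denote its number of vertices, and let $\delta^+(G)$ and $\Delta^+(G)$ denote the minimum and the maximum out-degree of its vertices. Let $\vec T_s$ be the transitive tournament on $s$ vertices. A $\vec T_s$-factor of $G$ is a set of pairwise vertex-disjoint subdigraphs of $G$, each isomorphic to $\vec T_s$, that together cover all vertices of $G$. An equitable acyclic $k$-coloring of $G$ is a coloring of the vertices of $G$ with $k$ colors (some color classes may be empty) such that every color class induces a subdigraph with no directed cycle (directed $2$-cycles included) and the sizes of any two color classes differ by at most one. (1) Let $s\ge 1$ and $k$ be integers. Every digraph $G$ with $|G|=n=sk$ and $\delta^+(G)\ge (1-1/s)n$ has a $\vec T_s$-factor. (2) Let $k$ be a nonnegative integer. Every digraph $G$ with $\Delta^+(G)\le k-1$ has an equitable acyclic $k$-coloring. -/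

import Mathlib

namespace Digraph

/-- A digraph is simple if it has no loops. (An adjacency relation already has at most one edge in
each direction between two vertices.) -/
def IsSimple {V : Type*} (G : Digraph V) : Prop :=
  ∀ v : V, ¬ G.Adj v v

/-- The out-degree `d⁺(v)`. -/
noncomputable def outDegree {V : Type*} (G : Digraph V) (v : V) : ℕ :=
  {w : V | G.Adj v w}.ncard

/-- The minimum out-degree `δ⁺(G)` (it is `0` if there are no vertices). -/
noncomputable def minOutDegree {V : Type*} (G : Digraph V) : ℕ :=
  ⨅ v : V, G.outDegree v

/-- The maximum out-degree `Δ⁺(G)` of a finite digraph (it is `0` if there are no vertices). -/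
noncomputable def maxOutDegree {V : Type*} [Fintype V] (G : Digraph V) : ℕ :=
  Finset.univ.sup G.outDegree

/-- The subdigraph induced on a set of vertices. -/
def induce {V : Type*} (G : Digraph V) (S : Set V) : Digraph S where
  Adj v w := G.Adj v w

/-- A digraph is acyclic if no vertex can be reached from itself by a directed walk of positive
length, i.e. if it has no directed cycle (2-cycles and loops included). -/
def IsAcyclic {V : Type*} (G : Digraph V) : Prop :=
  ∀ v : V, ¬ Relation.TransGen G.Adj v v

/-- `f` is an equitable acyclic `k`-coloring of `G`: each of its `k` color classes induces an
acyclic digraph, and the sizes of any two color classes differ by at most one. -/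
def IsEquitableAcyclicColoring {V : Type*} (G : Digraph V) {k : ℕ} (f : V → Fin k) : Prop :=
  (∀ i : Fin k, (G.induce (f ⁻¹' {i})).IsAcyclic) ∧
    ∀ i j : Fin k, (f ⁻¹' {i}).ncard ≤ (f ⁻¹' {j}).ncard + 1

/-- The transitive tournament on `s` vertices. -/
def transitiveTournament (s : ℕ) : Digraph (Fin s) where
  Adj i j := i < j

/-- A subdigraph (not necessarily induced or spanning): a set of vertices and a set of edges of `G`
with both ends among these vertices. -/
structure Subdigraph {V : Type*} (G : Digraph V) where
  verts : Set V
  Adj : V → V → Prop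
  adj_sub : ∀ {v w : V}, Adj v w → G.Adj v w
  fst_mem : ∀ {v w : V}, Adj v w → v ∈ verts
  snd_mem : ∀ {v w : V}, Adj v w → w ∈ verts

/-- A subdigraph as a digraph on its own vertex set. -/
def Subdigraph.coe {V : Type*} {G : Digraph V} (T : G.Subdigraph) : Digraph T.verts where
  Adj v w := T.Adj v w

/-- `T` is a copy of `H`, i.e. it is isomorphic to `H`. -/
def Subdigraph.IsCopyOf {V W : Type*} {G : Digraph V} (T : G.Subdigraph) (H : Digraph W) : Prop :=
  Nonempty (H.Adj ≃r T.coe.Adj)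

/-- `G` has an `H`-factor: a set of vertex-disjoint subdigraphs of `G` (tiles), each of them a copy
of `H`, which together cover all vertices of `G`. -/
def HasFactor {V W : Type*} (G : Digraph V) (H : Digraph W) : Prop :=
  ∃ F : Set G.Subdigraph,
    F.PairwiseDisjoint Subdigraph.verts ∧ (⋃ T ∈ F, T.verts) = Set.univ ∧ ∀ T ∈ F, T.IsCopyOf H

end Digraph

/-!
Part (1) follows from part (2) applied to the complementary digraph: its acyclic color classes of
size `s` are the vertex sets of transitive tournaments of the given digraph. For part (2) one may
assume `k ∣ |V|`, since a complete digraph can be added. As in Kierstead and Kostochka's proof of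
the Hajnal–Szemerédi theorem, the out-edges are switched on one vertex `u` at a time. Uncoloring
`u` leaves a near-equitable coloring, in which one class `a` is one vertex short. A color is
*accessible* if `a` can be reached from it by moving vertices from class to class without creating
a cycle. If an uncolored vertex, or a vertex with an inaccessible color, fits into an accessible
class, then shifting along such moves completes the coloring. Otherwise every inaccessible vertex
has an out-neighbor and an in-neighbor in each accessible class. Consider a set of accessible
classes none of which is needed by another color for reaching `a`, and which can be left only
through one further class. Counting the edges between these classes and the inaccessible vertices
in both directions gives inaccessible vertices `y`, `y'`, not on a common 2-cycle, and a vertex `z`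
of one of these classes which is the only out-neighbor of both in its class. Now `y` replaces `z`,
and the remaining inaccessible vertices are recolored by induction: either `z` can be moved on,
which completes the coloring, or the color of `y'` becomes accessible as well.
-/

namespace AcyclicColoring

open Finset Function
open scoped Classical

variable {V κ : Type*} {R : V → V → Prop}

/-- `R` has no directed cycle within the finite set `S`: every nonempty subset of `S` has a sink. -/
def AcyclicOn (R : V → V → Prop) (S : Finset V) : Prop :=
  ∀ T ⊆ S, T.Nonempty → ∃ v ∈ T, ∀ w ∈ T, ¬ R v w

section AcyclicOn

variable {S : Finset V}

lemma AcyclicOn.mono {R' : V → V → Prop} {S' : Finset V} (h : AcyclicOn R S) (hS : S' ⊆ S)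
    (hR : ∀ v ∈ S', ∀ w ∈ S', R' v w → R v w) : AcyclicOn R' S' := by
  intro T hT hne
  obtain ⟨v, hv, hvT⟩ := h T (hT.trans hS) hne
  exact ⟨v, hv, fun w hw hvw => hvT w hw (hR v (hT hv) w (hT hw) hvw)⟩

lemma AcyclicOn.subset {S' : Finset V} (h : AcyclicOn R S) (hS : S' ⊆ S) : AcyclicOn R S' :=
  h.mono hS fun _ _ _ _ => id

lemma AcyclicOn.insert_of_no_out (h : AcyclicOn R S) {y : V} (hyy : ¬ R y y)
    (hy : ∀ w ∈ S, ¬ R y w) : AcyclicOn R (insert y S) := by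
  intro T hT hne
  by_cases hyT : y ∈ T
  · refine ⟨y, hyT, fun w hw => ?_⟩
    rcases mem_insert.1 (hT hw) with rfl | hwS
    exacts [hyy, hy w hwS]
  · exact h T ((subset_insert_iff_of_notMem hyT).1 hT) hne

lemma AcyclicOn.insert_of_no_in (h : AcyclicOn R S) {y : V} (hyy : ¬ R y y)
    (hy : ∀ w ∈ S, ¬ R w y) : AcyclicOn R (insert y S) := by
  intro T hT hne
  have hTS : T.erase y ⊆ S := subset_insert_iff.1 hT
  rcases (T.erase y).eq_empty_or_nonempty with hT' | hT'
  · obtain rfl : T = {y} := ((erase_eq_empty_iff _ _).1 hT').resolve_left hne.ne_empty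
    exact ⟨y, by simpa using hyy⟩
  · obtain ⟨v, hv, hvT⟩ := h _ hTS hT'
    refine ⟨v, mem_of_mem_erase hv, fun w hw => ?_⟩
    by_cases hwy : w = y
    · exact hwy ▸ hy v (hTS hv)
    · exact hvT w (mem_erase.2 ⟨hwy, hw⟩)

lemma AcyclicOn.insert_insert_of_no_out (h : AcyclicOn R S) {y z : V} (hyy : ¬ R y y)
    (hzz : ¬ R z z) (hy : ∀ w ∈ S, ¬ R y w) (hz : ∀ w ∈ S, ¬ R z w) (hyz : ¬ (R y z ∧ R z y)) :
    AcyclicOn R (insert y (insert z S)) := by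
  by_cases hyz' : R y z
  · rw [insert_comm]
    exact (h.insert_of_no_out hyy hy).insert_of_no_out hzz
      (forall_mem_insert _ _ _ |>.2 ⟨fun hzy => hyz ⟨hyz', hzy⟩, hz⟩)
  · exact (h.insert_of_no_out hzz hz).insert_of_no_out hyy
      (forall_mem_insert _ _ _ |>.2 ⟨hyz', hy⟩)

lemma AcyclicOn.exists_out (h : AcyclicOn R S) {y : V} (hyy : ¬ R y y)
    (hy : ¬ AcyclicOn R (insert y S)) : ∃ w ∈ S, R y w := by
  contrapose! hy
  exact h.insert_of_no_out hyy hy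

lemma AcyclicOn.exists_in (h : AcyclicOn R S) {y : V} (hyy : ¬ R y y)
    (hy : ¬ AcyclicOn R (insert y S)) : ∃ w ∈ S, R w y := by
  contrapose! hy
  exact h.insert_of_no_in hyy hy

lemma AcyclicOn.two_le_card_in (h : AcyclicOn R S) {M : Finset V} {y : V} (hyy : ¬ R y y)
    (hy : ¬ AcyclicOn R (insert y S)) (hM : ∀ z ∈ M, ¬ AcyclicOn R (insert y (S.erase z))) :
    2 ≤ 2 * #{z ∈ S \ M | R z y} + #{z ∈ M | R z y} := by
  have hpos : ∀ w ∈ S, w ∉ M → R w y → 0 < #{z ∈ S \ M | R z y} := fun w hwS hwM hwy =>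
    card_pos.2 ⟨w, mem_filter.2 ⟨mem_sdiff.2 ⟨hwS, hwM⟩, hwy⟩⟩
  obtain ⟨w, hwS, hwy⟩ := h.exists_in hyy hy
  by_cases hwM : w ∈ M
  · obtain ⟨z, hz, hzy⟩ := (h.subset (erase_subset w S)).exists_in hyy (hM w hwM)
    obtain ⟨hzw, hzS⟩ := mem_erase.1 hz
    by_cases hzM : z ∈ M
    · have htwo : 1 < #{z ∈ M | R z y} :=
        one_lt_card.2 ⟨z, mem_filter.2 ⟨hzM, hzy⟩, w, mem_filter.2 ⟨hwM, hwy⟩, hzw⟩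
      omega
    · have := hpos z hzS hzM hzy
      omega
  · have := hpos w hwS hwM hwy
    omega

lemma AcyclicOn.exists_enum (h : AcyclicOn R S) {n : ℕ} (hn : #S = n) :
    ∃ e : Fin n ↪ V, Set.range e = S ∧ ∀ i j, i < j → ¬ R (e i) (e j) := by
  induction n generalizing S with
  | zero =>
    obtain rfl := card_eq_zero.1 hn
    exact ⟨Embedding.ofIsEmpty, by simp, fun i => i.elim0⟩
  | succ n ih =>
    obtain ⟨v, hv, hvS⟩ := h S Subset.rfl (card_pos.1 (by omega))
    obtain ⟨e, he, hlt⟩ := ih (h.subset (erase_subset v S)) (by rw [card_erase_of_mem hv]; omega)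
    have hmem : ∀ i, e i ∈ S.erase v := fun i => by
      rw [← mem_coe, ← he]
      exact Set.mem_range_self i
    refine ⟨⟨Fin.cons v e, Fin.cons_injective_iff.2 ⟨?_, e.injective⟩⟩, ?_, ?_⟩
    · rintro ⟨i, hi⟩
      exact ne_of_mem_erase (hmem i) hi
    · rw [Embedding.coeFn_mk, Fin.range_cons, he, ← coe_insert, insert_erase hv]
    · refine Fin.cases (fun j hj => ?_) fun i => Fin.cases (fun hij => ?_) fun j hij => ?_
      · obtain ⟨j, rfl⟩ := Fin.exists_succ_eq.2 hj.ne'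
        exact hvS _ (mem_of_mem_erase (hmem j))
      · exact absurd hij (Fin.not_lt_zero _)
      · exact hlt i j (Fin.succ_lt_succ_iff.1 hij)

lemma AcyclicOn.isAcyclic_induce {G : Digraph V} (h : AcyclicOn G.Adj S) :
    (G.induce (S : Set V)).IsAcyclic := by
  have hwf : WellFounded (swap (G.induce (S : Set V)).Adj) := by
    refine WellFounded.wellFounded_iff_has_min.2 fun T ⟨t, ht⟩ => ?_
    obtain ⟨v, hv, hvT⟩ := h {v ∈ S | ∃ hv, ⟨v, hv⟩ ∈ T} (filter_subset _ _)
      ⟨t, mem_filter.2 ⟨t.2, t.2, ht⟩⟩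
    obtain ⟨-, hvS, hv⟩ := mem_filter.1 hv
    exact ⟨⟨v, hvS⟩, hv, fun w hw => hvT w (mem_filter.2 ⟨w.2, w.2, hw⟩)⟩
  exact fun v hv => hwf.transGen.irrefl.irrefl v (Relation.transGen_swap.2 hv)

lemma AcyclicOn.toLeft {W : Type*} {Q : W → W → Prop} {S : Finset (V ⊕ W)}
    (h : AcyclicOn (Sum.LiftRel R Q) S) : AcyclicOn R S.toLeft := by
  intro T hT ⟨t, ht⟩
  have hsub : T.map .inl ⊆ S := map_subset_iff_subset_preimage.2 fun v hv => by
    simpa using hT hv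
  obtain ⟨_, hv, hvT⟩ := h (T.map .inl) hsub ⟨_, mem_map_of_mem _ ht⟩
  obtain ⟨v, hvT', rfl⟩ := mem_map.1 hv
  exact ⟨v, hvT', fun w hw hvw => hvT _ (mem_map_of_mem _ hw) (.inl hvw)⟩

lemma AcyclicOn.card_toRight_le_one {W : Type*} {S : Finset (V ⊕ W)}
    (h : AcyclicOn (Sum.LiftRel R (· ≠ ·)) S) : #S.toRight ≤ 1 := by
  refine card_le_one.2 fun i hi j hj => ?_
  by_contra hij
  obtain ⟨v, hv, hvT⟩ := h {.inr i, .inr j}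
    (insert_subset (mem_toRight.1 hi) (singleton_subset_iff.2 (mem_toRight.1 hj)))
    (insert_nonempty _ _)
  rcases mem_insert.1 hv with rfl | hv
  · exact hvT (.inr j) (by simp) (.inr hij)
  · obtain rfl := mem_singleton.1 hv
    exact hvT (.inr i) (by simp) (.inr (Ne.symm hij))

end AcyclicOn

section Colorings

/-- The vertices of `X` with color `c`. -/
noncomputable def colorClass (X : Finset V) (f : V → κ) (c : κ) : Finset V :=
  {v ∈ X | f v = c}

/-- `f` is a partial coloring of `X` with colors from `C` whose color classes are acyclic and have
the sizes prescribed by `σ`. Vertices with a color outside `C` count as uncolored. -/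
structure IsColoring (R : V → V → Prop) (X : Finset V) (C : Finset κ) (σ : κ → ℕ) (f : V → κ) :
    Prop where
  acyclic : ∀ c ∈ C, AcyclicOn R (colorClass X f c)
  card : ∀ c ∈ C, #(colorClass X f c) = σ c

variable {X : Finset V} {C A D : Finset κ} {σ : κ → ℕ} {f g : V → κ} {c d a : κ} {x y z : V}

@[simp] lemma mem_colorClass {v : V} : v ∈ colorClass X f c ↔ v ∈ X ∧ f v = c :=
  mem_filter

lemma colorClass_erase : colorClass (X.erase x) f c = (colorClass X f c).erase x :=
  filter_erase _ _ _

lemma colorClass_update_self (hx : x ∈ X) :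
    colorClass X (update f x c) c = insert x (colorClass X f c) := by
  ext v
  by_cases hv : v = x <;> simp [hv, hx]

lemma colorClass_update_of_ne (hd : d ≠ c) :
    colorClass X (update f x c) d = (colorClass X f d).erase x := by
  ext v
  by_cases hv : v = x <;> simp [hv, hd.symm]

lemma IsColoring.subset (h : IsColoring R X C σ f) (hA : A ⊆ C) : IsColoring R X A σ f :=
  ⟨fun c hc => h.acyclic c (hA hc), fun c hc => h.card c (hA hc)⟩

lemma card_filter_mem_eq_sum : #{v ∈ X | f v ∈ C} = ∑ c ∈ C, #(colorClass X f c) := by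
  have hmaps : Set.MapsTo f ({v ∈ X | f v ∈ C} : Finset V) C := fun v hv => (mem_filter.1 hv).2
  rw [card_eq_sum_card_fiberwise hmaps]
  refine sum_congr rfl fun c hc => congrArg card ?_
  ext v
  simp only [mem_filter, mem_colorClass]
  exact ⟨fun hv => ⟨hv.1.1, hv.2⟩, fun hv => ⟨⟨hv.1, hv.2 ▸ hc⟩, hv.2⟩⟩

lemma IsColoring.card_filter_mem (h : IsColoring R X C σ f) : #{v ∈ X | f v ∈ C} = ∑ c ∈ C, σ c :=
  card_filter_mem_eq_sum.trans (sum_congr rfl h.card)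

lemma IsColoring.mem_of_card_eq (h : IsColoring R X C σ f) (hX : #X = ∑ c ∈ C, σ c) :
    ∀ v ∈ X, f v ∈ C :=
  card_filter_eq_iff.1 (h.card_filter_mem.trans hX.symm)

lemma IsColoring.ite (hf : IsColoring R X A σ f) (hg : IsColoring R {v ∈ X | f v ∉ A} D σ g)
    (hAD : Disjoint A D) (hgA : ∀ v ∈ X, f v ∉ A → g v ∉ A) :
    IsColoring R X (A ∪ D) σ (fun v => if f v ∈ A then f v else g v) ∧
      ∀ c ∈ A, colorClass X (fun v => if f v ∈ A then f v else g v) c = colorClass X f c := by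
  have hclsA : ∀ c ∈ A,
      colorClass X (fun v => if f v ∈ A then f v else g v) c = colorClass X f c := by
    intro c hc
    ext v
    simp only [mem_colorClass]
    grind
  have hclsD : ∀ c ∈ D, colorClass X (fun v => if f v ∈ A then f v else g v) c =
      colorClass {v ∈ X | f v ∉ A} g c := by
    intro c hc
    have := disjoint_right.1 hAD hc
    ext v
    simp only [mem_colorClass, mem_filter]
    grind
  refine ⟨⟨fun c hc => ?_, fun c hc => ?_⟩, hclsA⟩ <;> rcases mem_union.1 hc with hc | hc
  · exact hclsA c hc ▸ hf.acyclic c hc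
  · exact hclsD c hc ▸ hg.acyclic c hc
  · exact hclsA c hc ▸ hf.card c hc
  · exact hclsD c hc ▸ hg.card c hc

lemma IsColoring.update_erase (h : IsColoring R (X.erase y) C σ f) (hd : d ∉ C) :
    IsColoring R X C σ (update f y d) := by
  have hcls : ∀ c ∈ C, colorClass X (update f y d) c = colorClass (X.erase y) f c := fun c hc => by
    rw [colorClass_update_of_ne (ne_of_mem_of_not_mem hc hd), colorClass_erase]
  exact ⟨fun c hc => hcls c hc ▸ h.acyclic c hc, fun c hc => hcls c hc ▸ h.card c hc⟩

lemma IsColoring.update_add_single (h : IsColoring R X C σ f) (hx : x ∈ X) (hxC : f x ∉ C)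
    (hxa : AcyclicOn R (insert x (colorClass X f a))) :
    IsColoring R X C (σ + Pi.single a 1) (update f x a) := by
  have hxc : ∀ c ∈ C, x ∉ colorClass X f c := fun c hc hx => hxC ((mem_colorClass.1 hx).2 ▸ hc)
  refine ⟨fun c hc => ?_, fun c hc => ?_⟩ <;> by_cases hca : c = a
  · rw [hca, colorClass_update_self hx]
    exact hxa
  · rw [colorClass_update_of_ne hca]
    exact (h.acyclic c hc).subset (erase_subset _ _)
  · subst hca
    simp [colorClass_update_self hx, card_insert_of_notMem (hxc c hc), h.card c hc]
  · simp [colorClass_update_of_ne hca, erase_eq_of_notMem (hxc c hc), h.card c hc, hca]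

lemma IsColoring.exists_exchange [Infinite κ] (h : IsColoring R X C σ f) (hy : y ∈ X)
    (hyC : f y ∉ C) (hc : c ∈ C) (hz : z ∈ colorClass X f c)
    (hyc : AcyclicOn R (insert y ((colorClass X f c).erase z))) :
    ∃ g, IsColoring R X C σ g ∧ g z ∉ C ∧
      colorClass X g c = insert y ((colorClass X f c).erase z) ∧
      (∀ d ∈ C, d ≠ c → colorClass X g d = colorClass X f d) ∧
      ∀ v, v ≠ y → v ≠ z → g v = f v := by
  obtain ⟨e, he⟩ := Infinite.exists_notMem_finset C
  have hzc := (mem_colorClass.1 hz).2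
  have hzy : z ≠ y := by rintro rfl; exact hyC (hzc ▸ hc)
  have hself : colorClass X (update (update f z e) y c) c =
      insert y ((colorClass X f c).erase z) := by
    rw [colorClass_update_self hy, colorClass_update_of_ne (ne_of_mem_of_not_mem hc he)]
  have hother : ∀ d ∈ C, d ≠ c →
      colorClass X (update (update f z e) y c) d = colorClass X f d := fun d hd hdc => by
    rw [colorClass_update_of_ne hdc, colorClass_update_of_ne (ne_of_mem_of_not_mem hd he),
      erase_eq_of_notMem (a := z) fun hz => hdc ((mem_colorClass.1 hz).2.symm.trans hzc),
      erase_eq_of_notMem (s := colorClass X f d) (a := y) fun hy' =>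
        hyC ((mem_colorClass.1 hy').2 ▸ hd)]
  have hycls : y ∉ (colorClass X f c).erase z := fun hy =>
    hyC ((mem_colorClass.1 (mem_of_mem_erase hy)).2 ▸ hc)
  refine ⟨update (update f z e) y c, ⟨fun d hd => ?_, fun d hd => ?_⟩, ?_, hself, hother, ?_⟩
  · by_cases hdc : d = c
    · rwa [hdc, hself]
    · exact hother d hd hdc ▸ h.acyclic d hd
  · by_cases hdc : d = c
    · rw [hdc, hself, card_insert_of_notMem hycls, card_erase_add_one hz, h.card c hc]
    · exact hother d hd hdc ▸ h.card d hd
  · simpa [hzy] using he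
  · intro v hvy hvz
    simp [hvy, hvz]

/-- Some vertex of color `c` can be moved to color class `d`. -/
def CanMove (R : V → V → Prop) (X : Finset V) (f : V → κ) (c d : κ) : Prop :=
  ∃ y ∈ colorClass X f c, AcyclicOn R (insert y (colorClass X f d))

end Colorings

section Reachability

variable {r r' : κ → κ → Prop} {P P' : Finset κ} {a b c u w : κ}

/-- The color `a` can be reached by an `r`-walk all of whose colors lie in `P`. This is a predicate
on the starting point of the walk. -/
inductive ReachesWithin (r : κ → κ → Prop) (P : Finset κ) (a : κ) : κ → Prop
  | refl : a ∈ P → ReachesWithin r P a a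
  | step {c d : κ} : c ∈ P → r c d → ReachesWithin r P a d → ReachesWithin r P a c

namespace ReachesWithin

lemma mem (h : ReachesWithin r P a c) : c ∈ P := by
  cases h <;> assumption

lemma target_mem (h : ReachesWithin r P a c) : a ∈ P := by
  induction h <;> assumption

lemma mono (h : ReachesWithin r P a c) (hP : ∀ d, ReachesWithin r P a d → d ∈ P')
    (hr : ∀ d ∈ P, ∀ e ∈ P, r d e → r' d e) : ReachesWithin r' P' a c := by
  induction h with
  | refl ha => exact refl (hP _ (refl ha))
  | step hc hcd hd ih => exact step (hP _ (step hc hcd hd)) (hr _ hc _ hd.mem hcd) ih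

lemma erase_or_exists_step (h : ReachesWithin r P a b) (hca : c ≠ a) :
    ReachesWithin r (P.erase c) a b ∨ ∃ d, r c d ∧ ReachesWithin r (P.erase c) a d := by
  induction h with
  | refl ha => exact .inl (refl (mem_erase.2 ⟨hca.symm, ha⟩))
  | @step b d hb hbd _ ih =>
    by_cases hbc : b = c
    · exact .inr (ih.elim (fun hd => ⟨d, hbc ▸ hbd, hd⟩) id)
    · exact ih.imp_left (step (mem_erase.2 ⟨hbc, hb⟩) hbd)

lemma exists_step (h : ReachesWithin r P a c) (hca : c ≠ a) :
    ∃ d, r c d ∧ ReachesWithin r (P.erase c) a d :=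
  (h.erase_or_exists_step hca).resolve_left fun h' => notMem_erase c P h'.mem

end ReachesWithin

/-- The colors which cannot reach `a` within `P` once `u` is removed. -/
noncomputable def cutOff (r : κ → κ → Prop) (P : Finset κ) (a u : κ) : Finset κ :=
  {c ∈ P.erase u | ¬ ReachesWithin r (P.erase u) a c}

lemma mem_cutOff : c ∈ cutOff r P a u ↔ c ∈ P.erase u ∧ ¬ ReachesWithin r (P.erase u) a c :=
  mem_filter

lemma cutOff_self : cutOff r P a a = P.erase a :=
  filter_eq_self.2 fun _ _ h => notMem_erase a P h.target_mem

lemma target_notMem_cutOff : a ∉ cutOff r P a u :=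
  fun h => (mem_cutOff.1 h).2 (.refl (mem_cutOff.1 h).1)

lemma ReachesWithin.erase_of_mem_cutOff (h : ReachesWithin r (P.erase u) a c)
    (hw : w ∈ cutOff r P a u) : ReachesWithin r (P.erase w) a c :=
  h.mono (fun _ hd => mem_erase.2 ⟨fun hdw => (mem_cutOff.1 hw).2 (hdw ▸ hd),
    mem_of_mem_erase hd.mem⟩) fun _ _ _ _ => id

lemma cutOff_ssubset (hu : ReachesWithin r P a u) (hw : w ∈ cutOff r P a u) :
    cutOff r P a w ⊂ cutOff r P a u := by
  have huw : u ∈ P.erase w := mem_erase.2 ⟨(ne_of_mem_erase (mem_cutOff.1 hw).1).symm, hu.mem⟩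
  have hu' : ReachesWithin r (P.erase w) a u := by
    by_cases hua : u = a
    · exact hua ▸ .refl (hua ▸ huw)
    · obtain ⟨d, hud, hd⟩ := hu.exists_step hua
      exact .step huw hud (hd.erase_of_mem_cutOff hw)
  refine (ssubset_iff_of_subset fun c hc => ?_).2
    ⟨w, hw, fun hw' => notMem_erase w P (mem_cutOff.1 hw').1⟩
  obtain ⟨hcP, hc⟩ := mem_cutOff.1 hc
  exact mem_cutOff.2 ⟨mem_erase.2 ⟨fun hcu => hc (hcu ▸ hu'), mem_of_mem_erase hcP⟩,
    fun hcu => hc (hcu.erase_of_mem_cutOff hw)⟩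

/-- A nonempty set `T` of colors, none of which is needed by another color for reaching `a` within
`P`, and which can be left only through `u`. -/
structure IsTerminalSet (r : κ → κ → Prop) (P : Finset κ) (a u : κ) (T : Finset κ) : Prop where
  subset : T ⊆ P.erase a
  nonempty : T.Nonempty
  reaches_erase : ∀ w ∈ T, ∀ c ∈ P.erase w, ReachesWithin r (P.erase w) a c
  step_mem : ∀ c ∈ T, ∀ d ∈ P, r c d → d ∈ insert u T

lemma exists_isTerminalSet (hP : ∀ c ∈ P, ReachesWithin r P a c) (hne : (P.erase a).Nonempty) :
    ∃ u ∈ P, ∃ T, IsTerminalSet r P a u T := by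
  obtain ⟨c₀, hc₀⟩ := hne
  have ha : a ∈ P := (hP c₀ (mem_of_mem_erase hc₀)).target_mem
  obtain ⟨u, hu, hmin⟩ := exists_min_image {u ∈ P | (cutOff r P a u).Nonempty}
    (fun u => #(cutOff r P a u)) ⟨a, mem_filter.2 ⟨ha, c₀, cutOff_self ▸ hc₀⟩⟩
  obtain ⟨huP, hune⟩ := mem_filter.1 hu
  refine ⟨u, huP, cutOff r P a u, fun c hc => mem_erase.2
    ⟨ne_of_mem_of_not_mem hc target_notMem_cutOff, mem_of_mem_erase (mem_cutOff.1 hc).1⟩, hune,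
    fun w hw c hc => ?_, fun c hc d hd hcd => ?_⟩
  · by_contra hcw
    have hwP : w ∈ P := mem_of_mem_erase (mem_cutOff.1 hw).1
    exact (card_lt_card (cutOff_ssubset (hP u huP) hw)).not_ge
      (hmin w (mem_filter.2 ⟨hwP, c, mem_cutOff.2 ⟨hc, hcw⟩⟩))
  · obtain ⟨hcP, hc⟩ := mem_cutOff.1 hc
    by_contra hdT
    obtain ⟨hdu, hdT⟩ := not_or.1 (mt mem_insert.2 hdT)
    refine hc (.step hcP hcd ?_)
    by_contra hd'
    exact hdT (mem_cutOff.2 ⟨mem_erase.2 ⟨hdu, hd⟩, hd'⟩)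

end Reachability

section Counting

variable {B : Finset V}

lemma sum_card_filter_comm {α β : Type*} (P : α → β → Prop) (A : Finset α) (B : Finset β) :
    ∑ x ∈ A, #{y ∈ B | P x y} = ∑ y ∈ B, #{x ∈ A | P x y} :=
  sum_card_bipartiteAbove_eq_sum_card_bipartiteBelow P

lemma lt_of_two_le_in_degrees {M N : Finset V} {q t : ℕ}
    (hB : ∀ y ∈ B, 2 ≤ 2 * #{z ∈ N | R z y} + #{z ∈ M | R z y})
    (hN : ∀ z ∈ N, #{y ∈ B | R z y} ≤ q) (hM : ∀ z ∈ M, #{y ∈ B | R z y} ≤ q + t)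
    (hcard : q * (#M + #N) < #B) : q < t := by
  have hsum : #B * 2 ≤ 2 * ∑ z ∈ N, #{y ∈ B | R z y} + ∑ z ∈ M, #{y ∈ B | R z y} := by
    rw [sum_card_filter_comm R N B, sum_card_filter_comm R M B, mul_sum, ← sum_add_distrib,
      ← smul_eq_mul]
    exact card_nsmul_le_sum _ _ _ hB
  have hsumN : ∑ z ∈ N, #{y ∈ B | R z y} ≤ #N * q := sum_le_card_nsmul _ _ _ hN
  have hsumM : ∑ z ∈ M, #{y ∈ B | R z y} ≤ #M * (q + t) := sum_le_card_nsmul _ _ _ hM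
  by_contra! htq
  have hMq : #M * (q + t) ≤ #M * (q + q) := Nat.mul_le_mul_left _ (by omega)
  nlinarith

lemma exists_two_cycle_free_subset (R : V → V → Prop) (B : Finset V) :
    ∃ I ⊆ B, (I : Set V).Pairwise (fun y z => ¬ (R y z ∧ R z y)) ∧
      #B ≤ ∑ y ∈ I, (#{w ∈ B | R y w} + 1) := by
  obtain ⟨I, hI, hmax⟩ := exists_max_image
    (B.powerset.filter fun I : Finset V => (I : Set V).Pairwise fun y z => ¬ (R y z ∧ R z y))
    card ⟨∅, by simp⟩
  obtain ⟨hIB, hpair⟩ := mem_filter.1 hI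
  rw [mem_powerset] at hIB
  have hcover : B ⊆ I.biUnion fun y => insert y {w ∈ B | R y w} := by
    intro v hv
    by_contra hvcover
    simp only [mem_biUnion, mem_insert, mem_filter, not_exists, not_and, not_or] at hvcover
    have hvI : v ∉ I := fun h => (hvcover v h).1 rfl
    have hvpair : ((insert v I : Finset V) : Set V).Pairwise fun y z => ¬ (R y z ∧ R z y) := by
      rw [coe_insert, Set.pairwise_insert]
      exact ⟨hpair, fun y hy _ =>
        ⟨fun h => (hvcover y hy).2 hv h.2, fun h => (hvcover y hy).2 hv h.1⟩⟩
    have hle := hmax (insert v I)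
      (mem_filter.2 ⟨mem_powerset.2 (insert_subset hv hIB), hvpair⟩)
    rw [card_insert_of_notMem hvI] at hle
    omega
  exact ⟨I, hIB, hpair, (card_le_card hcover).trans <| card_biUnion_le.trans <|
    sum_le_sum fun y _ => card_insert_le _ _⟩

lemma exists_common_of_card_out_add_le {S : Finset V} {q t s : ℕ} {P : V → V → Prop}
    (hP : ∀ y ∈ B, t + (#{w ∈ B | R y w} + 1) ≤ q + #{z ∈ S | P y z})
    (hq : ∀ y ∈ B, #{w ∈ B | R y w} < q) (hqt : q < t) (hB : q * s < #B) (hS : #S = t * s) :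
    ∃ y ∈ B, ∃ y' ∈ B, y ≠ y' ∧ ¬ (R y y' ∧ R y' y) ∧ ∃ z ∈ S, P y z ∧ P y' z := by
  obtain ⟨I, hIB, hpair, hBI⟩ := exists_two_cycle_free_subset R B
  have hI : ∑ y ∈ I, (t + (#{w ∈ B | R y w} + 1)) ≤ ∑ y ∈ I, (q + #{z ∈ S | P y z}) :=
    sum_le_sum fun y hy => hP y (hIB hy)
  rw [sum_add_distrib, sum_add_distrib (f := fun _ => q), sum_const, sum_const, smul_eq_mul,
    smul_eq_mul, sum_card_filter_comm] at hI
  have hIq : ∑ y ∈ I, (#{w ∈ B | R y w} + 1) ≤ #I * q :=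
    sum_le_card_nsmul _ _ _ fun y hy => hq y (hIB hy)
  have hsI : s < #I := lt_of_mul_lt_mul_left (hB.trans_le (hBI.trans (hIq.trans_eq (mul_comm _ _))))
    (Nat.zero_le q)
  have hpigeon : ∑ _z ∈ S, 1 < ∑ z ∈ S, #{y ∈ I | P y z} := by
    rw [sum_const, smul_eq_mul, mul_one, hS]
    obtain ⟨e, rfl⟩ := Nat.exists_eq_add_of_lt hqt
    nlinarith [hsI]
  obtain ⟨z, hz, hlt⟩ := exists_lt_of_sum_lt hpigeon
  obtain ⟨y, hy, y', hy', hne⟩ := one_lt_card.1 hlt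
  rw [mem_filter] at hy hy'
  exact ⟨y, hIB hy.1, y', hIB hy'.1, hne, hpair hy.1 hy'.1 hne, z, hz, hy.2, hy'.2⟩

end Counting

section NearEquitable

variable {X B : Finset V} {C P : Finset κ} {σ : κ → ℕ} {f g : V → κ} {a c d : κ} {r : ℕ}
  {v x y z : V}

lemma CanMove.congr (h : CanMove R X f c d) (hc : colorClass X g c = colorClass X f c)
    (hd : colorClass X g d = colorClass X f d) : CanMove R X g c d := by
  rwa [CanMove, hc, hd]

-- Put `x` into class `c`, a movable vertex of `c` into the next class of the walk, and so on.
lemma IsColoring.exists_of_reachesWithin [Infinite κ] (h : IsColoring R X C σ f) (hP : P ⊆ C)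
    (hx : x ∈ X) (hxC : f x ∉ C) (hxc : AcyclicOn R (insert x (colorClass X f c)))
    (hc : ReachesWithin (CanMove R X f) P a c) :
    ∃ g, IsColoring R X C (σ + Pi.single a 1) g := by
  induction P using Finset.strongInduction generalizing f x c with
  | H P ih =>
    by_cases hca : c = a
    · exact ⟨_, h.update_add_single hx hxC (hca ▸ hxc)⟩
    obtain ⟨d, ⟨y, hy, hyd⟩, hd⟩ := hc.exists_step hca
    obtain ⟨g, hg, hgy, -, hcls, -⟩ := h.exists_exchange hx hxC (hP hc.mem) hy
      (hxc.subset (insert_subset_insert _ (erase_subset _ _)))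
    have hcls' : ∀ e ∈ P.erase c, colorClass X g e = colorClass X f e := fun e he =>
      hcls e (hP (mem_of_mem_erase he)) (ne_of_mem_erase he)
    refine ih (P.erase c) (erase_ssubset hc.mem) hg ((erase_subset _ _).trans hP)
      (mem_colorClass.1 hy).1 hgy ((hcls' d hd.mem).symm ▸ hyd) ?_
    exact hd.mono (fun _ => ReachesWithin.mem) fun e he e' he' hee' =>
      hee'.congr (hcls' e he) (hcls' e' he')

lemma IsColoring.card_out_add_card_le (h : IsColoring R X C σ f) (hP : P ⊆ C) (hvv : ¬ R v v)
    (hv : ∀ c ∈ P, ¬ AcyclicOn R (insert v (colorClass X f c)))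
    (hB : B ⊆ {w ∈ X | f w ∉ P}) : #{w ∈ B | R v w} + #P ≤ #{w ∈ X | R v w} := by
  have hsurj : Set.SurjOn f ({w ∈ X | R v w ∧ f w ∈ P} : Finset V) P := by
    intro c hc
    obtain ⟨w, hw, hvw⟩ := (h.acyclic c (hP hc)).exists_out hvv (hv c hc)
    obtain ⟨hwX, rfl⟩ := mem_colorClass.1 hw
    exact ⟨w, mem_filter.2 ⟨hwX, hvw, hc⟩, rfl⟩
  have hsub : {w ∈ B | R v w} ⊆ {w ∈ X | R v w ∧ f w ∉ P} := fun w hw =>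
    have hw := mem_filter.1 hw
    have hwB := mem_filter.1 (hB hw.1)
    mem_filter.2 ⟨hwB.1, hw.2, hwB.2⟩
  rw [← card_filter_add_card_filter_not (s := {w ∈ X | R v w}) (fun w => f w ∈ P), filter_filter,
    filter_filter, add_comm]
  exact add_le_add (card_le_card_of_surjOn f hsurj) (card_le_card hsub)

/-- An acyclic coloring of `X` with colors from `C` and all classes of size `s`. -/
def HasEquitableColoring (R : V → V → Prop) (X : Finset V) (C : Finset κ) (s : ℕ) : Prop :=
  ∃ g, IsColoring R X C (fun _ => s) g

/-- `f` is one vertex short of an equitable coloring of `X`: class `a` has size `r` instead of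
`r + 1`, so that a single vertex is left uncolored. -/
structure IsNearEquitable (R : V → V → Prop) (X : Finset V) (C : Finset κ) (r : ℕ) (a : κ)
    (f : V → κ) : Prop where
  mem : a ∈ C
  card_eq : #X = #C * (r + 1)
  isColoring : IsColoring R X C (update (fun _ => r + 1) a r) f

/-- The colors from which color `a` can be reached by successively moving vertices. -/
noncomputable def accessible (R : V → V → Prop) (X : Finset V) (C : Finset κ) (a : κ)
    (f : V → κ) : Finset κ :=
  {c ∈ C | ReachesWithin (CanMove R X f) C a c}

/-- The vertices without an accessible color, including the uncolored ones. -/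
noncomputable def inaccessible (R : V → V → Prop) (X : Finset V) (C : Finset κ) (a : κ)
    (f : V → κ) : Finset V :=
  {v ∈ X | f v ∉ accessible R X C a f}

lemma accessible_subset : accessible R X C a f ⊆ C := filter_subset _ _

lemma inaccessible_subset : inaccessible R X C a f ⊆ X := filter_subset _ _

lemma mem_accessible : c ∈ accessible R X C a f ↔ ReachesWithin (CanMove R X f) C a c :=
  mem_filter.trans (and_iff_right_of_imp ReachesWithin.mem)

lemma reachesWithin_accessible (hc : c ∈ accessible R X C a f) :
    ReachesWithin (CanMove R X f) (accessible R X C a f) a c :=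
  (mem_accessible.1 hc).mono (fun _ => mem_accessible.2) fun _ _ _ _ => id

namespace IsNearEquitable

lemma self_mem_accessible (h : IsNearEquitable R X C r a f) : a ∈ accessible R X C a f :=
  mem_accessible.2 (.refl h.mem)

lemma exists_of_reachesWithin [Infinite κ] (h : IsNearEquitable R X C r a f) (hP : P ⊆ C)
    (hx : x ∈ X) (hxC : f x ∉ C) (hxc : AcyclicOn R (insert x (colorClass X f c)))
    (hc : ReachesWithin (CanMove R X f) P a c) : HasEquitableColoring R X C (r + 1) := by
  obtain ⟨g, hg⟩ := h.isColoring.exists_of_reachesWithin hP hx hxC hxc hc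
  have hσ : update (fun _ => r + 1) a r + Pi.single a 1 = fun _ => r + 1 := by
    ext c
    by_cases hc : c = a <;> simp [hc]
  exact ⟨g, hσ ▸ hg⟩

lemma exists_of_acyclicOn_insert [Infinite κ] (h : IsNearEquitable R X C r a f)
    (hy : y ∈ inaccessible R X C a f) (hc : c ∈ accessible R X C a f)
    (hyc : AcyclicOn R (insert y (colorClass X f c))) : HasEquitableColoring R X C (r + 1) := by
  obtain ⟨hyX, hyA⟩ := mem_filter.1 hy
  have hc' := mem_accessible.1 hc
  refine h.exists_of_reachesWithin Subset.rfl hyX (fun hyC => hyA ?_) hyc hc'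
  exact mem_accessible.2 (.step hyC ⟨y, mem_colorClass.2 ⟨hyX, rfl⟩, hyc⟩ hc')

lemma card_inaccessible (h : IsNearEquitable R X C r a f) :
    #(inaccessible R X C a f) = #(C \ accessible R X C a f) * (r + 1) + 1 := by
  have ha := h.self_mem_accessible
  rw [inaccessible]
  set A := accessible R X C a f
  have hAC : A ⊆ C := accessible_subset
  have hA := (h.isColoring.subset hAC).card_filter_mem
  rw [sum_update_of_mem ha, sum_const, smul_eq_mul, sdiff_singleton_eq_erase] at hA
  have hX := h.card_eq
  rw [← card_filter_add_card_filter_not (s := X) (fun v => f v ∈ A), hA,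
    ← card_sdiff_add_card_eq_card hAC, ← card_erase_add_one ha] at hX
  linarith

lemma card_colorClass_of_ne (h : IsNearEquitable R X C r a f) (hc : c ∈ C) (hca : c ≠ a) :
    #(colorClass X f c) = r + 1 := by
  rw [h.isColoring.card c hc, update_of_ne hca]

lemma card_colorClass_self (h : IsNearEquitable R X C r a f) : #(colorClass X f a) = r := by
  rw [h.isColoring.card a h.mem, update_self]

end IsNearEquitable

/-- A near-equitable coloring in which no vertex of `inaccessible` fits into an accessible class. -/
structure IsStuck (R : V → V → Prop) (X : Finset V) (C : Finset κ) (r : ℕ) (a : κ) (f : V → κ) :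
    Prop extends IsNearEquitable R X C r a f where
  blocked : ∀ y ∈ inaccessible R X C a f, ∀ c ∈ accessible R X C a f,
    ¬ AcyclicOn R (insert y (colorClass X f c))

namespace IsStuck

lemma card_out_lt (h : IsStuck R X C r a f) (hR : ∀ v, ¬ R v v)
    (hdeg : ∀ v ∈ X, #{w ∈ X | R v w} < #C) (hy : y ∈ inaccessible R X C a f) :
    #{w ∈ inaccessible R X C a f | R y w} < #(C \ accessible R X C a f) := by
  have hle := h.isColoring.card_out_add_card_le accessible_subset (hR y) (h.blocked y hy) Subset.rfl
  have hlt := hle.trans_lt (hdeg y (inaccessible_subset hy))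
  rw [← card_sdiff_add_card_eq_card accessible_subset (s := accessible R X C a f)] at hlt
  exact Nat.lt_of_add_lt_add_right hlt

lemma hasEquitableColoring_erase (h : IsStuck R X C r a f) (hR : ∀ v, ¬ R v v)
    (hdeg : ∀ v ∈ X, #{w ∈ X | R v w} < #C)
    (ih : ∀ X' ⊂ X, ∀ C' : Finset κ, #X' = #C' * (r + 1) →
      (∀ v ∈ X', #{w ∈ X' | R v w} < #C') → HasEquitableColoring R X' C' (r + 1))
    (hy : y ∈ inaccessible R X C a f) :
    HasEquitableColoring R ((inaccessible R X C a f).erase y) (C \ accessible R X C a f)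
      (r + 1) := by
  refine ih _ ((erase_ssubset hy).trans_subset inaccessible_subset) _ ?_ fun v hv => ?_
  · rw [card_erase_of_mem hy, h.card_inaccessible, Nat.add_sub_cancel]
  · exact (card_le_card (filter_subset_filter _ (erase_subset _ _))).trans_lt
      (h.card_out_lt hR hdeg (mem_of_mem_erase hv))

-- If only `a` were accessible, every inaccessible vertex would have an in-neighbor among the `r`
-- vertices of class `a`, whose out-degrees are too small for that.
lemma nonempty_accessible_erase (h : IsStuck R X C r a f) (hR : ∀ v, ¬ R v v)
    (hdeg : ∀ v ∈ X, #{w ∈ X | R v w} < #C) : ((accessible R X C a f).erase a).Nonempty := by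
  by_contra hne
  have hA : accessible R X C a f = {a} :=
    ((erase_eq_empty_iff _ _).1 (not_nonempty_iff_eq_empty.1 hne)).resolve_left
      (ne_empty_of_mem h.self_mem_accessible)
  have hcard := h.card_inaccessible
  have hC := card_sdiff_add_card_eq_card (accessible_subset (R := R) (X := X) (C := C) (a := a)
    (f := f))
  have hB := h.blocked
  rw [hA, card_singleton] at *
  set B := inaccessible R X C a f
  have hin : ∀ y ∈ B, 1 ≤ #{z ∈ colorClass X f a | R z y} := fun y hy =>
    card_pos.2 <| filter_nonempty_iff.2 <|
      (h.isColoring.acyclic a h.mem).exists_in (hR y) (hB y hy a (mem_singleton_self a))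
  have hout : ∀ z ∈ colorClass X f a, #{y ∈ B | R z y} ≤ #(C \ {a}) := fun z hz => by
    have hle : #{y ∈ B | R z y} ≤ #{y ∈ X | R z y} :=
      card_le_card (filter_subset_filter _ inaccessible_subset)
    have hlt := hdeg z (mem_colorClass.1 hz).1
    omega
  have hcount := sum_card_filter_comm R (colorClass X f a) B
  have hge := card_nsmul_le_sum B _ 1 hin
  have hle := sum_le_card_nsmul _ _ _ hout
  rw [smul_eq_mul, mul_one] at hge
  rw [smul_eq_mul, h.card_colorClass_self] at hle
  linarith

end IsStuck

lemma IsNearEquitable.exists_exchange [Infinite κ] (h : IsNearEquitable R X C r a f)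
    (hy : y ∈ inaccessible R X C a f)
    (hrec : HasEquitableColoring R ((inaccessible R X C a f).erase y) (C \ accessible R X C a f)
      (r + 1))
    (hc : c ∈ accessible R X C a f) (hz : z ∈ colorClass X f c)
    (hyz : AcyclicOn R (insert y ((colorClass X f c).erase z))) :
    ∃ g, IsNearEquitable R X C r a g ∧ g z ∉ C ∧
      colorClass X g c = insert y ((colorClass X f c).erase z) ∧
      (∀ d ∈ (accessible R X C a f).erase c, colorClass X g d = colorClass X f d) ∧
      ∀ v ∈ (inaccessible R X C a f).erase y, g v ∈ C \ accessible R X C a f := by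
  have haA := h.self_mem_accessible
  have hBcard := h.card_inaccessible
  rw [inaccessible] at *
  set A := accessible R X C a f
  have hAC : A ⊆ C := accessible_subset
  obtain ⟨hyX, hyA⟩ := mem_filter.1 hy
  obtain ⟨g₀, hg₀⟩ := hrec
  have hg₀C : ∀ v ∈ ({v ∈ X | f v ∉ A} : Finset V).erase y, g₀ v ∈ C \ A := hg₀.mem_of_card_eq <| by
    rw [card_erase_of_mem hy, hBcard, Nat.add_sub_cancel, sum_const, smul_eq_mul]
  have hg₀σ : IsColoring R (({v ∈ X | f v ∉ A} : Finset V).erase y) (C \ A)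
      (update (fun _ => r + 1) a r) g₀ := ⟨hg₀.acyclic, fun d hd => by
    rw [hg₀.card d hd, update_of_ne (ne_of_mem_of_not_mem haA (mem_sdiff.1 hd).2).symm]⟩
  obtain ⟨e, he⟩ := Infinite.exists_notMem_finset C
  obtain ⟨hφ, hφA⟩ := (h.isColoring.subset hAC).ite
    (hg₀σ.update_erase (d := e) fun he' => he (mem_sdiff.1 he').1) disjoint_sdiff
    fun v hvX hvA => by
      by_cases hvy : v = y
      · rw [hvy, update_self]
        exact fun heA => he (hAC heA)
      · rw [update_of_ne hvy]
        exact (mem_sdiff.1 (hg₀C v (mem_erase.2 ⟨hvy, mem_filter.2 ⟨hvX, hvA⟩⟩))).2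
  rw [union_sdiff_of_subset hAC] at hφ
  rw [← hφA c hc] at hz hyz ⊢
  obtain ⟨g, hg, hgz, hgc, hgd, hgv⟩ := hφ.exists_exchange hyX (by simpa [hyA] using he)
    (hAC hc) hz hyz
  refine ⟨g, ⟨h.mem, h.card_eq, hg⟩, hgz, hgc, fun d hd => ?_, fun v hv => ?_⟩
  · obtain ⟨hdc, hd⟩ := mem_erase.1 hd
    rw [hgd d (hAC hd) hdc, hφA d hd]
  · obtain ⟨hvy, hv'⟩ := mem_erase.1 hv
    have hvA := (mem_filter.1 hv').2
    rw [hφA c hc] at hz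
    have hvz : v ≠ z := fun hvz => hvA (hvz ▸ (mem_colorClass.1 hz).2 ▸ hc)
    simpa [hgv v hvy hvz, hvA, hvy] using hg₀C v hv

lemma IsNearEquitable.exists_of_exchange [Infinite κ] (h : IsNearEquitable R X C r a f)
    (hy : y ∈ inaccessible R X C a f)
    (hrec : HasEquitableColoring R ((inaccessible R X C a f).erase y) (C \ accessible R X C a f)
      (r + 1))
    (hc : c ∈ accessible R X C a f) (hz : z ∈ colorClass X f c)
    (hyz : AcyclicOn R (insert y ((colorClass X f c).erase z)))
    (hzd : AcyclicOn R (insert z (colorClass X f d)))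
    (hd : ReachesWithin (CanMove R X f) ((accessible R X C a f).erase c) a d) :
    HasEquitableColoring R X C (r + 1) := by
  obtain ⟨g, hg, hgz, -, hcls, -⟩ := h.exists_exchange hy hrec hc hz hyz
  have hd' : ReachesWithin (CanMove R X g) ((accessible R X C a f).erase c) a d :=
    hd.mono (fun _ => ReachesWithin.mem) fun e he e' he' hee' =>
      hee'.congr (hcls e he) (hcls e' he')
  exact hg.exists_of_reachesWithin ((erase_subset _ _).trans accessible_subset)
    (mem_colorClass.1 hz).1 hgz ((hcls d hd.mem).symm ▸ hzd) hd'

lemma IsNearEquitable.exists_card_accessible_lt [Infinite κ] (h : IsNearEquitable R X C r a f)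
    (hR : ∀ v, ¬ R v v) (hy : y ∈ inaccessible R X C a f)
    (hrec : HasEquitableColoring R ((inaccessible R X C a f).erase y) (C \ accessible R X C a f)
      (r + 1))
    (hc : c ∈ (accessible R X C a f).erase a)
    (hreach : ∀ d ∈ (accessible R X C a f).erase c,
      ReachesWithin (CanMove R X f) ((accessible R X C a f).erase c) a d)
    (hz : z ∈ colorClass X f c)
    (hzd : ∀ d ∈ (accessible R X C a f).erase c, ¬ AcyclicOn R (insert z (colorClass X f d)))
    (hx : x ∈ (inaccessible R X C a f).erase y) (hyx : ¬ (R y x ∧ R x y))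
    (hyc : ∀ w ∈ (colorClass X f c).erase z, ¬ R y w)
    (hxc : ∀ w ∈ (colorClass X f c).erase z, ¬ R x w) :
    ∃ g, IsNearEquitable R X C r a g ∧ #(accessible R X C a f) < #(accessible R X C a g) := by
  obtain ⟨hca, hcA⟩ := mem_erase.1 hc
  have hcz : AcyclicOn R ((colorClass X f c).erase z) :=
    (h.isColoring.acyclic c (accessible_subset hcA)).subset (erase_subset _ _)
  obtain ⟨g, hg, -, hgc, hgd, hgB⟩ :=
    h.exists_exchange hy hrec hcA hz (hcz.insert_of_no_out (hR y) hyc)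
  obtain ⟨hxC, hxA⟩ := mem_sdiff.1 (hgB x hx)
  have hreach' : ∀ d ∈ (accessible R X C a f).erase c, d ∈ accessible R X C a g := fun d hd =>
    mem_accessible.2 <| (hreach d hd).mono
      (fun _ he => accessible_subset (mem_of_mem_erase he.mem))
      fun e he e' he' hee' => hee'.congr (hgd e he) (hgd e' he')
  have hcA' : c ∈ accessible R X C a g := by
    obtain ⟨d, ⟨v, hv, hvd⟩, hd⟩ := (reachesWithin_accessible hcA).exists_step hca
    have hvz : v ≠ z := fun hvz => hzd d hd.mem (hvz ▸ hvd)
    refine mem_accessible.2 (.step (accessible_subset hcA) ⟨v, ?_, (hgd d hd.mem).symm ▸ hvd⟩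
      (mem_accessible.1 (hreach' d hd.mem)))
    exact hgc ▸ mem_insert_of_mem (mem_erase.2 ⟨hvz, hv⟩)
  have hxA' : g x ∈ accessible R X C a g := by
    have hxX := inaccessible_subset (mem_of_mem_erase hx)
    refine mem_accessible.2 (.step hxC ⟨x, mem_colorClass.2 ⟨hxX, rfl⟩, ?_⟩
      (mem_accessible.1 hcA'))
    rw [hgc]
    exact hcz.insert_insert_of_no_out (hR x) (hR y) hxc hyc (mt And.symm hyx)
  refine ⟨g, hg, card_lt_card ((ssubset_iff_of_subset fun d hd => ?_).2 ⟨g x, hxA', hxA⟩)⟩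
  by_cases hdc : d = c
  · exact hdc ▸ hcA'
  · exact hreach' d (mem_erase.2 ⟨hdc, hd⟩)

/-- `z` is the only out-neighbor of `y` in its color class, so that `y` may take the place of `z`
without creating a cycle in that class. -/
def IsSolo (R : V → V → Prop) (X : Finset V) (f : V → κ) (y z : V) : Prop :=
  R y z ∧ ∀ w ∈ colorClass X f (f z), R y w → w = z

lemma two_mul_card_le_card_out_add_card_isSolo {T : Finset κ}
    (hy : ∀ c ∈ T, ∃ w ∈ colorClass X f c, R y w) :
    2 * #T ≤ #{w ∈ {v ∈ X | f v ∈ T} | R y w} + #{z ∈ {v ∈ X | f v ∈ T} | IsSolo R X f y z} := by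
  have hclass : ∀ c ∈ T,
      2 ≤ #(colorClass {w ∈ X | R y w} f c) + #(colorClass {z ∈ X | IsSolo R X f y z} f c) := by
    intro c hc
    obtain ⟨w, hw, hyw⟩ := hy c hc
    obtain ⟨hwX, rfl⟩ := mem_colorClass.1 hw
    have hwout : w ∈ colorClass {w ∈ X | R y w} f (f w) :=
      mem_colorClass.2 ⟨mem_filter.2 ⟨hwX, hyw⟩, rfl⟩
    by_cases hsolo : IsSolo R X f y w
    · have hwsolo : w ∈ colorClass {z ∈ X | IsSolo R X f y z} f (f w) :=
        mem_colorClass.2 ⟨mem_filter.2 ⟨hwX, hsolo⟩, rfl⟩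
      have hpos := card_pos.2 ⟨w, hwout⟩
      have hpos' := card_pos.2 ⟨w, hwsolo⟩
      omega
    · obtain ⟨w', hw', hyw', hne⟩ : ∃ w' ∈ colorClass X f (f w), R y w' ∧ w' ≠ w := by
        by_contra! hall
        exact hsolo ⟨hyw, hall⟩
      obtain ⟨hwX', hww'⟩ := mem_colorClass.1 hw'
      exact le_add_right
        (one_lt_card.2 ⟨w', mem_colorClass.2 ⟨mem_filter.2 ⟨hwX', hyw'⟩, hww'⟩, w, hwout, hne⟩)
  have hsum := card_nsmul_le_sum T _ 2 hclass
  rwa [sum_add_distrib, ← card_filter_mem_eq_sum, ← card_filter_mem_eq_sum, filter_comm,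
    filter_comm (fun z => IsSolo R X f y z), smul_eq_mul, mul_comm] at hsum

namespace IsStuck

variable {T : Finset κ} {u : κ}

lemma card_add_card_out_le (h : IsStuck R X C r a f) (hR : ∀ v, ¬ R v v)
    (hdeg : ∀ v ∈ X, #{w ∈ X | R v w} < #C) (hT : T ⊆ accessible R X C a f)
    (hy : y ∈ inaccessible R X C a f) :
    #T + (#{w ∈ inaccessible R X C a f | R y w} + 1) ≤
      #(C \ accessible R X C a f) + #{z ∈ {v ∈ X | f v ∈ T} | IsSolo R X f y z} := by
  have hlt := hdeg y (inaccessible_subset hy)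
  have hblocked := h.blocked y hy
  rw [inaccessible]
  set A := accessible R X C a f
  have hAC : A ⊆ C := accessible_subset
  have hsolo := two_mul_card_le_card_out_add_card_isSolo fun c hc =>
    (h.isColoring.acyclic c (hAC (hT hc))).exists_out (hR y) (hblocked c (hT hc))
  have hout := h.isColoring.card_out_add_card_le (B := {v ∈ X | f v ∉ A} ∪ {v ∈ X | f v ∈ T})
    (sdiff_subset.trans hAC) (hR y) (fun c hc => hblocked c (mem_sdiff.1 hc).1)
    (union_subset (monotone_filter_right _ fun v _ hv hv' => hv (mem_sdiff.1 hv').1)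
      (monotone_filter_right _ fun v _ hv hv' => (mem_sdiff.1 hv').2 hv))
  have hdisj : Disjoint {v ∈ X | f v ∉ A} {v ∈ X | f v ∈ T} :=
    disjoint_filter.2 fun v _ hvA hvT => hvA (hT hvT)
  rw [filter_union, card_union_of_disjoint (disjoint_filter_filter hdisj)] at hout
  have hA := card_sdiff_add_card_eq_card hT
  have hC := card_sdiff_add_card_eq_card hAC
  omega

lemma card_sdiff_lt_of_terminal (h : IsStuck R X C r a f) (hR : ∀ v, ¬ R v v)
    (hdeg : ∀ v ∈ X, #{w ∈ X | R v w} < #C)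
    (hT : IsTerminalSet (CanMove R X f) (accessible R X C a f) a u T) (hc : c ∈ T)
    (hswap : ∀ y ∈ inaccessible R X C a f, ∀ z ∈ colorClass X f c,
      AcyclicOn R (insert y ((colorClass X f c).erase z)) →
        ∀ d ∈ (accessible R X C a f).erase c, ¬ AcyclicOn R (insert z (colorClass X f d))) :
    #(C \ accessible R X C a f) < #T := by
  obtain ⟨hca, hcA⟩ := mem_erase.1 (hT.subset hc)
  have hcC : c ∈ C := accessible_subset hcA
  have hBcard := h.card_inaccessible
  have hblocked := h.blocked
  have hBX : inaccessible R X C a f ⊆ {v ∈ X | f v ∉ accessible R X C a f} := Subset.rfl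
  set A := accessible R X C a f
  set B := inaccessible R X C a f
  have hAC : A ⊆ C := accessible_subset
  have hC := card_sdiff_add_card_eq_card hAC
  have hout : ∀ z ∈ colorClass X f c, ∀ P ⊆ A,
      (∀ d ∈ P, ¬ AcyclicOn R (insert z (colorClass X f d))) → #{y ∈ B | R z y} + #P < #C :=
    fun z hz P hP hzP => (h.isColoring.card_out_add_card_le (hP.trans hAC) (hR z) hzP
      (hBX.trans (monotone_filter_right _ fun v _ hv hv' => hv (hP hv')))).trans_lt
      (hdeg z (mem_colorClass.1 hz).1)
  set M := {z ∈ colorClass X f c | ∃ d ∈ A.erase c, AcyclicOn R (insert z (colorClass X f d))}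
  refine lt_of_two_le_in_degrees (R := R) (B := B) (M := M) (N := colorClass X f c \ M) ?_ ?_ ?_ ?_
  · refine fun y hy => (h.isColoring.acyclic c hcC).two_le_card_in (hR y) (hblocked y hy c hcA) ?_
    intro z hz hyz
    obtain ⟨hzc, d, hd, hzd⟩ := mem_filter.1 hz
    exact hswap y hy z hzc hyz d hd hzd
  · intro z hz
    obtain ⟨hzc, hzM⟩ := mem_sdiff.1 hz
    have hlt := hout z hzc (A.erase c) (erase_subset _ _) fun d hd hzd =>
      hzM (mem_filter.2 ⟨hzc, d, hd, hzd⟩)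
    rw [card_erase_of_mem hcA] at hlt
    omega
  · intro z hz
    have hzc := (mem_filter.1 hz).1
    have hlt := hout z hzc (A \ insert u T) sdiff_subset fun d hd hzd =>
      (mem_sdiff.1 hd).2 (hT.step_mem c hc d (mem_sdiff.1 hd).1 ⟨z, hzc, hzd⟩)
    have hle := le_card_sdiff (insert u T) A
    have hins := card_insert_le u T
    omega
  · rw [add_comm, card_sdiff_add_card_eq_card (filter_subset _ _),
      h.card_colorClass_of_ne hcC hca, hBcard]
    exact Nat.lt_succ_self _

lemma hasEquitableColoring_or_exists [Infinite κ] (h : IsStuck R X C r a f) (hR : ∀ v, ¬ R v v)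
    (hdeg : ∀ v ∈ X, #{w ∈ X | R v w} < #C)
    (ih : ∀ X' ⊂ X, ∀ C' : Finset κ, #X' = #C' * (r + 1) →
      (∀ v ∈ X', #{w ∈ X' | R v w} < #C') → HasEquitableColoring R X' C' (r + 1)) :
    HasEquitableColoring R X C (r + 1) ∨
      ∃ g, IsNearEquitable R X C r a g ∧ #(accessible R X C a f) < #(accessible R X C a g) := by
  refine or_iff_not_imp_left.2 fun hnot => ?_
  obtain ⟨u, -, T, hT⟩ := exists_isTerminalSet (fun _ => reachesWithin_accessible)
    (h.nonempty_accessible_erase hR hdeg)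
  have hrec := fun y => h.hasEquitableColoring_erase (y := y) hR hdeg ih
  have hTA : T ⊆ accessible R X C a f := hT.subset.trans (erase_subset _ _)
  have hswap : ∀ c ∈ T, ∀ y ∈ inaccessible R X C a f, ∀ z ∈ colorClass X f c,
      AcyclicOn R (insert y ((colorClass X f c).erase z)) →
        ∀ d ∈ (accessible R X C a f).erase c, ¬ AcyclicOn R (insert z (colorClass X f d)) :=
    fun c hc y hy z hz hyz d hd hzd => hnot <|
      h.exists_of_exchange hy (hrec y hy) (hTA hc) hz hyz hzd (hT.reaches_erase c hc d hd)
  obtain ⟨c, hc⟩ := hT.nonempty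
  have hlt := h.card_sdiff_lt_of_terminal hR hdeg hT hc (hswap c hc)
  have hTcard : #{v ∈ X | f v ∈ T} = #T * (r + 1) := by
    rw [card_filter_mem_eq_sum, sum_congr rfl fun d hd => h.card_colorClass_of_ne
      (accessible_subset (hTA hd)) (ne_of_mem_erase (hT.subset hd)), sum_const, smul_eq_mul]
  obtain ⟨y, hy, x, hx, hyx, hcycle, z, hz, hyz, hxz⟩ :=
    exists_common_of_card_out_add_le (P := IsSolo R X f)
      (fun y => h.card_add_card_out_le hR hdeg hTA) (fun y => h.card_out_lt hR hdeg) hlt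
      (h.card_inaccessible ▸ Nat.lt_succ_self _) hTcard
  obtain ⟨hzX, hzT⟩ := mem_filter.1 hz
  have hzc : z ∈ colorClass X f (f z) := mem_colorClass.2 ⟨hzX, rfl⟩
  have hno_out : ∀ {v}, IsSolo R X f v z → ∀ w ∈ (colorClass X f (f z)).erase z, ¬ R v w :=
    fun hv w hw hvw => ne_of_mem_erase hw (hv.2 w (mem_of_mem_erase hw) hvw)
  have hacyclic : AcyclicOn R (insert y ((colorClass X f (f z)).erase z)) :=
    ((h.isColoring.acyclic _ (accessible_subset (hTA hzT))).subset
      (erase_subset _ _)).insert_of_no_out (hR y) (hno_out hyz)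
  exact h.exists_card_accessible_lt hR hy (hrec y hy) (hT.subset hzT) (hT.reaches_erase _ hzT) hzc
    (hswap _ hzT y hy z hzc hacyclic) (mem_erase.2 ⟨hyx.symm, hx⟩) hcycle (hno_out hyz)
    (hno_out hxz)

end IsStuck

lemma IsNearEquitable.hasEquitableColoring [Infinite κ] (h : IsNearEquitable R X C r a f)
    (hR : ∀ v, ¬ R v v) (hdeg : ∀ v ∈ X, #{w ∈ X | R v w} < #C)
    (ih : ∀ X' ⊂ X, ∀ C' : Finset κ, #X' = #C' * (r + 1) →
      (∀ v ∈ X', #{w ∈ X' | R v w} < #C') → HasEquitableColoring R X' C' (r + 1)) :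
    HasEquitableColoring R X C (r + 1) := by
  by_contra hnot
  have hgrow : ∀ n, ∃ g, IsNearEquitable R X C r a g ∧ n ≤ #(accessible R X C a g) := by
    intro n
    induction n with
    | zero => exact ⟨f, h, Nat.zero_le _⟩
    | succ n ihn =>
      obtain ⟨g, hg, hn⟩ := ihn
      have hstuck : IsStuck R X C r a g := ⟨hg, fun y hy c hc hyc =>
        hnot (hg.exists_of_acyclicOn_insert hy hc hyc)⟩
      obtain ⟨g', hg', hlt⟩ := (hstuck.hasEquitableColoring_or_exists hR hdeg ih).resolve_left hnot
      exact ⟨g', hg', hn.trans_lt hlt⟩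
  obtain ⟨g, -, hg⟩ := hgrow (#C + 1)
  exact (Nat.lt_of_succ_le hg).not_ge (card_le_card accessible_subset)

end NearEquitable

section Equitable

variable {X : Finset V} {C : Finset κ} {R' : V → V → Prop} {g : V → κ} {e : κ} {u : V} {r s : ℕ}

lemma exists_card_colorClass_eq [Nonempty κ] {σ : κ → ℕ} (hX : #X = ∑ c ∈ C, σ c) :
    ∃ f : V → κ, (∀ v ∈ X, f v ∈ C) ∧ ∀ c ∈ C, #(colorClass X f c) = σ c := by
  induction C using Finset.induction_on generalizing X with
  | empty =>
    obtain rfl : X = ∅ := by simpa using hX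
    exact ⟨fun _ => Classical.arbitrary κ, by simp⟩
  | insert c C hc ih =>
    rw [sum_insert hc] at hX
    obtain ⟨S, hSX, hS⟩ := exists_subset_card_eq (s := X) (n := σ c) (by omega)
    obtain ⟨f, hfC, hf⟩ := ih (X := X \ S) (by rw [card_sdiff_of_subset hSX]; omega)
    refine ⟨fun v => if v ∈ S then c else f v, fun v hv => ?_,
      forall_mem_insert _ _ _ |>.2 ⟨?_, ?_⟩⟩
    · grind
    · rw [← hS]
      congr 1
      ext v
      simp only [mem_colorClass]
      grind
    · intro d hd
      rw [← hf d hd]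
      congr 1
      ext v
      simp only [mem_colorClass]
      grind

lemma IsColoring.isNearEquitable_update (hg : IsColoring R X C (fun _ => r + 1) g)
    (hX : #X = #C * (r + 1)) (hR' : ∀ v w, v ≠ u → R' v w → R v w) (hu : u ∈ X) (he : e ∉ C) :
    IsNearEquitable R' X C r (g u) (update g u e) := by
  have hcls : ∀ c ∈ C, colorClass X (update g u e) c = (colorClass X g c).erase u := fun c hc =>
    colorClass_update_of_ne (ne_of_mem_of_not_mem hc he)
  refine ⟨hg.mem_of_card_eq (by rw [hX, sum_const, smul_eq_mul]) u hu, hX,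
    fun c hc => ?_, fun c hc => ?_⟩ <;> rw [hcls c hc]
  · exact (hg.acyclic c hc).mono (erase_subset _ _) fun v hv w _ => hR' v w (ne_of_mem_erase hv)
  · by_cases hcu : c = g u
    · subst hcu
      rw [card_erase_of_mem (mem_colorClass.2 ⟨hu, rfl⟩), hg.card _ hc, update_self,
        Nat.add_sub_cancel]
    · rw [erase_eq_of_notMem fun hu' => hcu (mem_colorClass.1 hu').2.symm, hg.card c hc,
        update_of_ne hcu]

theorem hasEquitableColoring [Infinite κ] (hR : ∀ v, ¬ R v v) (hX : #X = #C * s)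
    (hdeg : ∀ v ∈ X, #{w ∈ X | R v w} < #C) : HasEquitableColoring R X C s := by
  induction X using Finset.strongInduction generalizing R C with
  | H X ih =>
    -- Switch on the out-edges of the vertices of `X` one vertex after the other.
    have hpartial : ∀ L ⊆ X, HasEquitableColoring (fun v w => v ∈ L ∧ R v w) X C s := by
      intro L hL
      induction L using Finset.induction_on with
      | empty =>
        obtain ⟨g, -, hg⟩ := exists_card_colorClass_eq (σ := fun _ => s)
          (hX.trans (sum_const_nat fun _ _ => rfl).symm)
        exact ⟨g, fun c _ T _ ⟨v, hv⟩ => ⟨v, hv, by simp⟩, hg⟩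
      | insert u L _ ihL =>
        obtain ⟨huX, hLX⟩ := insert_subset_iff.1 hL
        obtain ⟨g, hg⟩ := ihL hLX
        obtain ⟨e, he⟩ := Infinite.exists_notMem_finset C
        obtain ⟨r, rfl⟩ : ∃ r, s = r + 1 :=
          Nat.exists_eq_succ_of_ne_zero fun hs => (card_pos.2 ⟨u, huX⟩).ne' (by simp [hX, hs])
        have hnear : IsNearEquitable (fun v w => v ∈ insert u L ∧ R v w) X C r (g u)
            (update g u e) :=
          hg.isNearEquitable_update hX
            (fun v w hvu hvw => ⟨mem_of_mem_insert_of_ne hvw.1 hvu, hvw.2⟩) huX he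
        refine hnear.hasEquitableColoring (fun v hv => hR v hv.2) (fun v hv => ?_)
          fun X' hX' C' => ih X' hX' fun v hv => hR v hv.2
        exact lt_of_le_of_lt (card_le_card fun w => by grind) (hdeg v hv)
    obtain ⟨g, hg⟩ := hpartial X Subset.rfl
    exact ⟨g, fun c hc => (hg.acyclic c hc).mono Subset.rfl
      fun v hv w _ hvw => ⟨(mem_colorClass.1 hv).1, hvw⟩, hg.card⟩

variable [Fintype V] {k : ℕ}

lemma exists_fin_coloring_card_eq (hR : ∀ v, ¬ R v v) (hcard : Fintype.card V = k * s)
    (hdeg : ∀ v, #{w | R v w} < k) :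
    ∃ f : V → Fin k, ∀ c, AcyclicOn R {v | f v = c} ∧ #{v | f v = c} = s := by
  have hX : #(univ : Finset V) = #(range k) * s := by rw [card_univ, hcard, card_range]
  obtain ⟨g, hg⟩ := hasEquitableColoring hR hX (by simpa using hdeg)
  have hgk : ∀ v, g v < k := fun v =>
    mem_range.1 (hg.mem_of_card_eq (by rw [hX, sum_const, smul_eq_mul]) v (mem_univ v))
  have hcls : ∀ c : Fin k, ({v | (⟨g v, hgk v⟩ : Fin k) = c} : Finset V) = colorClass univ g c := by
    intro c
    ext v
    simp [Fin.ext_iff]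
  refine ⟨fun v => ⟨g v, hgk v⟩, fun c => ?_⟩
  rw [hcls]
  exact ⟨hg.acyclic c (mem_range.2 c.2), hg.card c (mem_range.2 c.2)⟩

lemma card_filter_liftRel_inl {W : Type*} [Fintype W] {Q : W → W → Prop} (v : V)
    [DecidablePred (Sum.LiftRel R Q (.inl v))] :
    #{x | Sum.LiftRel R Q (.inl v) x} = #{w | R v w} := by
  rw [← card_map (Embedding.inl : V ↪ V ⊕ W)]
  congr 1
  ext (w | j) <;> simp

lemma card_filter_liftRel_ne_inr {W : Type*} [Fintype W] (i : W)
    [DecidablePred (Sum.LiftRel R (· ≠ ·) (.inr i))] :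
    #{x | Sum.LiftRel R (· ≠ ·) (.inr i) x} = Fintype.card W - 1 := by
  rw [← card_univ, ← card_erase_of_mem (mem_univ i), ← card_map (Embedding.inr : W ↪ V ⊕ W)]
  congr 1
  ext (w | j) <;> simp [eq_comm]

-- Adding a complete digraph on `k - |V| % k` vertices makes the number of vertices divisible by
-- `k`, and each color class contains at most one of the new vertices.
lemma exists_fin_coloring (hR : ∀ v, ¬ R v v) (hk : 0 < k) (hdeg : ∀ v, #{w | R v w} < k) :
    ∃ f : V → Fin k, ∀ c, AcyclicOn R {v | f v = c} ∧
      Fintype.card V / k ≤ #{v | f v = c} ∧ #{v | f v = c} ≤ Fintype.card V / k + 1 := by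
  set n := Fintype.card V with hn
  have hmod := Nat.mod_lt n hk
  have hdiv := Nat.div_add_mod n k
  obtain ⟨g, hg⟩ := exists_fin_coloring_card_eq
    (V := V ⊕ Fin (k - n % k)) (R := Sum.LiftRel R (· ≠ ·)) (k := k) (s := n / k + 1)
    (by rintro (v | i) <;> simp [hR])
    (by
      rw [Fintype.card_sum, Fintype.card_fin, ← hn, mul_add, mul_one]
      omega)
    (by
      rintro (v | i)
      · rw [card_filter_liftRel_inl]
        exact hdeg v
      · rw [card_filter_liftRel_ne_inr, Fintype.card_fin]
        omega)
  refine ⟨fun v => g (.inl v), fun c => ?_⟩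
  have hleft : ({v | g (.inl v) = c} : Finset V) =
      ({x | g x = c} : Finset (V ⊕ Fin (k - n % k))).toLeft := by
    ext v
    simp
  obtain ⟨hc, hcard⟩ := hg c
  have hright := hc.card_toRight_le_one
  rw [← card_toLeft_add_card_toRight] at hcard
  rw [hleft]
  exact ⟨hc.toLeft, by omega, by omega⟩

end Equitable

section Digraph

variable (G : Digraph V)

lemma hasFactor_of_embeddings {W ι : Type*} {H : Digraph W} (e : ι → W ↪ V)
    (hadj : ∀ c i j, H.Adj i j → G.Adj (e c i) (e c j))
    (hdisj : Pairwise (Disjoint on fun c => Set.range (e c)))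
    (hcover : ⋃ c, Set.range (e c) = Set.univ) : G.HasFactor H := by
  let T : ι → G.Subdigraph := fun c =>
    { verts := Set.range (e c)
      Adj := Relation.Map H.Adj (e c) (e c)
      adj_sub := by rintro _ _ ⟨i, j, hij, rfl, rfl⟩; exact hadj c i j hij
      fst_mem := by rintro _ _ ⟨i, j, -, rfl, rfl⟩; exact ⟨i, rfl⟩
      snd_mem := by rintro _ _ ⟨i, j, -, rfl, rfl⟩; exact ⟨j, rfl⟩ }
  refine ⟨Set.range T, ?_, by rwa [Set.biUnion_range], ?_⟩
  · rintro _ ⟨c, rfl⟩ _ ⟨d, rfl⟩ hcd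
    exact hdisj (ne_of_apply_ne T hcd)
  · rintro _ ⟨c, rfl⟩
    exact ⟨⟨Equiv.ofInjective (e c) (e c).injective,
      Relation.map_apply_apply (e c).injective (e c).injective _ _ _⟩⟩

variable {k s : ℕ}

lemma outDegree_eq_card [Fintype V] (v : V) : G.outDegree v = #{w | G.Adj v w} := by
  rw [Digraph.outDegree, Set.ncard_eq_toFinset_card', Set.toFinset_ofPred]

lemma hasFactor_transitiveTournament [Fintype V] (hG : G.IsSimple)
    (hcard : Fintype.card V = k * s) (hdeg : ∀ v, Fintype.card V ≤ G.outDegree v + k) :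
    G.HasFactor (Digraph.transitiveTournament s) := by
  have hdeg' : ∀ v, #{w | v ≠ w ∧ ¬ G.Adj v w} < k := fun v => by
    have hout := hdeg v
    have hsplit := card_filter_add_card_filter_not (s := univ) fun w => G.Adj v w
    have hlt : #{w | v ≠ w ∧ ¬ G.Adj v w} < #{w | ¬ G.Adj v w} := by
      refine card_lt_card ((ssubset_iff_of_subset fun w => by grind).2 ⟨v, ?_⟩)
      simpa using hG v
    rw [outDegree_eq_card, ← card_univ] at hout
    omega
  obtain ⟨f, hf⟩ := exists_fin_coloring_card_eq (R := fun v w => v ≠ w ∧ ¬ G.Adj v w)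
    (fun v hv => hv.1 rfl) hcard fun v => by convert hdeg' v
  choose e hrange hlt using fun c => (hf c).1.exists_enum (hf c).2
  have hcolor : ∀ c, Set.range (e c) = f ⁻¹' {c} := fun c => (hrange c).trans (by ext; simp)
  refine hasFactor_of_embeddings G e (fun c i j hij => ?_) (fun c d hcd => ?_) ?_
  · by_contra hadj
    exact hlt c i j hij ⟨(e c).injective.ne (ne_of_lt hij), hadj⟩
  · simpa only [onFun, hcolor] using pairwise_disjoint_fiber f hcd
  · rw [Set.iUnion_congr hcolor, ← Set.preimage_iUnion, Set.iUnion_of_singleton, Set.preimage_univ]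

lemma exists_isEquitableAcyclicColoring [Finite V] (hG : G.IsSimple) (hk : 0 < k)
    (hdeg : ∀ v, G.outDegree v < k) : ∃ f : V → Fin k, G.IsEquitableAcyclicColoring f := by
  have := Fintype.ofFinite V
  obtain ⟨f, hf⟩ := exists_fin_coloring hG hk fun v => outDegree_eq_card G v ▸ hdeg v
  have hcolor : ∀ c, f ⁻¹' {c} = (({v | f v = c} : Finset V) : Set V) := fun c => by ext; simp
  refine ⟨f, fun c => ?_, fun c d => ?_⟩
  · rw [hcolor]
    exact (hf c).1.isAcyclic_induce
  · rw [hcolor, hcolor, Set.ncard_coe_finset, Set.ncard_coe_finset]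
    exact (hf c).2.2.trans (Nat.add_le_add_right (hf d).2.1 1)

end Digraph

end AcyclicColoring

theorem theorem9 :
    (∀ (V : Type*) [Fintype V] (G : Digraph V) (s k : ℕ), G.IsSimple → 1 ≤ s →
      Fintype.card V = s * k →
      (1 - 1 / (s : ℝ)) * (Fintype.card V : ℝ) ≤ (G.minOutDegree : ℝ) →
      G.HasFactor (Digraph.transitiveTournament s)) ∧
    (∀ (V : Type*) [Fintype V] (G : Digraph V) (k : ℕ), G.IsSimple →
      (G.maxOutDegree : ℤ) ≤ (k : ℤ) - 1 →
      ∃ f : V → Fin k, G.IsEquitableAcyclicColoring f) := by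
  refine ⟨fun V _ G s k hG hs hcard hdeg => ?_, fun V _ G k hG hdeg => ?_⟩
  · refine AcyclicColoring.hasFactor_transitiveTournament G hG (hcard.trans (mul_comm s k))
      fun v => ?_
    have hmin : (G.minOutDegree : ℝ) ≤ G.outDegree v :=
      Nat.cast_le.2 (ciInf_le (OrderBot.bddBelow _) v)
    have hsk : (1 - 1 / (s : ℝ)) * (Fintype.card V : ℝ) = Fintype.card V - k := by
      rw [hcard]
      push_cast
      field_simp
    have hle : (Fintype.card V : ℝ) ≤ (G.outDegree v + k : ℕ) := by
      push_cast
      linarith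
    exact_mod_cast hle
  · have hmax : ∀ v, G.outDegree v ≤ G.maxOutDegree := fun v => Finset.le_sup (Finset.mem_univ v)
    exact AcyclicColoring.exists_isEquitableAcyclicColoring G hG (by omega) fun v =>
      (hmax v).trans_lt (by omega)
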